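/- For integers $n\ge 1$ and $0\le k\le n-1$ let $\mathcal H$ be the space of (real- or complex-valued) functions $f$ on $[0,1]$ whose derivatives $f, f',\dots,f^{(n-1)}$ are absolutely continuous on $[0,1]$, with $f^{(n)}\in L_2[0,1]$ and $f^{(j)}(0)=f^{(j)}(1)=0$ for $j=0,\dots,n-1$, normed by $\|f\|_{\mathcal H}=\bigl(\int_0^1|f^{(n)}(x)|^2\,dx\bigr)^{1/2}$. For $a\in[0,1]$ put $$A_{n,k}(a)=\sup\{\,|f^{(k)}(a)| : f\in\mathcal H,\ \|f\|_{\mathcal H}\le 1\,\}.$$ Then for all integers $n\ge1$ and $0\le k\le n-1$ there is a real polynomial $B_{n,k}$ of degree exactly $k$ with constant term $(n-k)^2$ such that for every $a\in[0,1]$ the supremum $A_{n,k}(a)$ is finite and, with $t=a^2-a$, $$A_{n,k}^2(a)=-\frac{t^{2n-2k-1}}{((n-k)!)^2\,(2n-2k-1)}\,B_{n,k}(t).$$ -/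

import Mathlib

open MeasureTheory Set

noncomputable section

namespace SobolevPoint

/-- The derivative `f^{(j)}` on `[0,1]` (one-sided at the end points). -/
abbrev D {𝕜 : Type*} [RCLike 𝕜] (j : ℕ) (f : ℝ → 𝕜) : ℝ → 𝕜 :=
  iteratedDerivWithin j f (Icc (0 : ℝ) 1)

/-- `f` belongs to the Sobolev space of order `n` on `[0,1]` with zero boundary values: the
derivatives of order at most `n - 1` exist everywhere on `[0,1]` and are absolutely continuous,
the `n`-th derivative (which then exists almost everywhere) is square integrable, and
`f^{(j)}(0) = f^{(j)}(1) = 0` for `j = 0, …, n - 1`. Only the values of `f` on `[0,1]` matter. -/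
structure MemH {𝕜 : Type*} [RCLike 𝕜] (n : ℕ) (f : ℝ → 𝕜) : Prop where
  differentiableOn : ∀ j : ℕ, j + 1 < n → DifferentiableOn ℝ (D j f) (Icc (0 : ℝ) 1)
  absolutelyContinuous : ∀ j : ℕ, j < n → AbsolutelyContinuousOnInterval (D j f) 0 1
  memLp : MemLp (D n f) 2 (volume.restrict (Icc (0 : ℝ) 1))
  left_eq_zero : ∀ j : ℕ, j < n → D j f 0 = 0
  right_eq_zero : ∀ j : ℕ, j < n → D j f 1 = 0

/-- The norm `‖f‖ = (∫₀¹ |f^{(n)}(x)|² dx)^{1/2}`. -/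
def normH {𝕜 : Type*} [RCLike 𝕜] (n : ℕ) (f : ℝ → 𝕜) : ℝ :=
  Real.sqrt (∫ x in Icc (0 : ℝ) 1, ‖D n f x‖ ^ 2)

/-- The set of values `|f^{(k)}(a)|`, where `f` runs over the unit ball of the space of order `n`. -/
def pointValues (𝕜 : Type*) [RCLike 𝕜] (n k : ℕ) (a : ℝ) : Set ℝ :=
  {r : ℝ | ∃ f : ℝ → 𝕜, MemH n f ∧ normH n f ≤ 1 ∧ r = ‖D k f a‖}

/-- `A_{n,k}(a) = sup { |f^{(k)}(a)| : ‖f‖ ≤ 1 }`. -/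
def A (𝕜 : Type*) [RCLike 𝕜] (n k : ℕ) (a : ℝ) : ℝ :=
  sSup (pointValues 𝕜 n k a)

end SobolevPoint

end

noncomputable section

namespace SobolevPoint

open Polynomial

/-! ### Polynomials symmetric about `1/2` -/

/-! Put `d = n - k - 1` and `φ_a(x) = (a - x)₊^d / d!`. The zero boundary values at `0` and repeated
integration give `f^{(k)}(a) = ∫ φ_a f^{(n)}`. The boundary values at `1` say exactly that `f^{(n)}`
is orthogonal to all polynomials of degree less than `n`. Hence `A_{n,k}(a)` is the `L²` distance
from `φ_a` to these polynomials: Cauchy–Schwarz bounds it above (`MemH.sq_norm_le`), and the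
`n`-fold primitive of the normalised projection error attains it
(`IsProjection.sqrt_mem_pointValues`).

For orthonormal polynomials `p_i` the squared distance is `P(a) = a^(2d+1) / ((2d+1) d!²) - ∑_{i<n}
(I^(d+1) p_i)(a)²`, where `I` integrates from `0`. Each square is divisible by `a^(2d+2)`, so the
first term alone gives the lowest coefficient, and the square with `i = n - 1` alone gives the
degree `2(n + d)`. Reflection `x ↦ 1 - x` gives `P(1 - a) = P(a)` (`exists_distance_polynomial`).
Symmetry and the zero of order `2d + 1` then force `P = t^(2d+1) S(t)` with `t = a² - a`, and `S`
has degree `(n + d) - (2d + 1) = k` (`exists_pow_mul_comp_of_symmetric_of_odd`). -/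

lemma eval_one_sub_of_comp_eq {P : ℝ[X]} (hP : P.comp (1 - X) = P) (x : ℝ) :
    P.eval (1 - x) = P.eval x := by
  conv_rhs => rw [← hP]
  simp [eval_comp]

lemma X_sq_sub_X_monic : (X ^ 2 - X : ℝ[X]).Monic := by
  monicity!

lemma X_sq_sub_X_natDegree : (X ^ 2 - X : ℝ[X]).natDegree = 2 := by
  compute_degree!

lemma comp_one_sub_cancel {Q : ℝ[X]}
    (h : ((X ^ 2 - X) * Q).comp (1 - X) = (X ^ 2 - X) * Q) : Q.comp (1 - X) = Q := by
  have h0 : (X ^ 2 - X : ℝ[X]) ≠ 0 := X_sq_sub_X_monic.ne_zero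
  apply mul_left_cancel₀ h0
  rw [← h, mul_comp]
  congr 1
  simp
  ring

/-- A polynomial invariant under `x ↦ 1 - x` is a polynomial in `x² - x`. -/
lemma exists_comp_of_symmetric (P : ℝ[X]) (hP : P.comp (1 - X) = P) :
    ∃ S : ℝ[X], P = S.comp (X ^ 2 - X) := by
  induction hN : P.natDegree using Nat.strong_induction_on generalizing P with
  | _ N ih =>
    subst hN
    by_cases hdeg : P.natDegree = 0
    · obtain ⟨c, hc⟩ := natDegree_eq_zero.mp hdeg
      exact ⟨C c, by rw [C_comp, hc]⟩
    have h01 : P.eval 1 = P.eval 0 := by simpa using eval_one_sub_of_comp_eq hP 0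
    -- By symmetry `P - P(0)` vanishes at both `0` and `1`; dividing by `X² - X` keeps the symmetry
    -- and lowers the degree.
    have hdvd : (X ^ 2 - X : ℝ[X]) ∣ P - C (P.eval 0) := by
      have h0 : (X : ℝ[X]) ∣ P - C (P.eval 0) := by
        rw [X_dvd_iff, coeff_zero_eq_eval_zero]; simp
      have h1 : (X - C 1 : ℝ[X]) ∣ P - C (P.eval 0) := by
        rw [dvd_iff_isRoot]; simp [h01]
      have hco : IsCoprime (X : ℝ[X]) (X - C 1) := ⟨1, -1, by simp⟩
      have := hco.mul_dvd h0 h1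
      convert this using 1
      simp; ring
    obtain ⟨Q, hQ⟩ := hdvd
    have hP' : P = (X ^ 2 - X) * Q + C (P.eval 0) := by rw [← hQ]; ring
    have hQ0 : Q ≠ 0 := by
      rintro rfl
      apply hdeg
      rw [hP']; simp
    have hsym : Q.comp (1 - X) = Q := by
      apply comp_one_sub_cancel
      rw [← hQ, sub_comp, hP, C_comp]
    have hnd : P.natDegree = 2 + Q.natDegree := by
      conv_lhs => rw [hP']
      rw [natDegree_add_C, X_sq_sub_X_monic.natDegree_mul' hQ0, X_sq_sub_X_natDegree]
    obtain ⟨S, hS⟩ := ih Q.natDegree (by omega) Q hsym rfl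
    refine ⟨X * S + C (P.eval 0), ?_⟩
    simp only [add_comp, mul_comp, X_comp, C_comp]
    rw [← hS]
    exact hP'

/-- The symmetry carries each zero at `0` over to `1`, so factors `X² - X` can be split off one at a
time. -/
lemma exists_pow_mul_comp_of_symmetric (r : ℕ) (P : ℝ[X]) (hP : P.comp (1 - X) = P)
    (hr : X ^ r ∣ P) : ∃ S : ℝ[X], P = (X ^ 2 - X) ^ r * S.comp (X ^ 2 - X) := by
  induction r generalizing P with
  | zero => simpa using exists_comp_of_symmetric P hP
  | succ r ih =>
    have hX : (X : ℝ[X]) ∣ P := (dvd_pow_self X (Nat.succ_ne_zero r)).trans hr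
    have h0 : P.eval 0 = 0 := by rwa [X_dvd_iff, coeff_zero_eq_eval_zero] at hX
    have h1 : (X - C 1 : ℝ[X]) ∣ P := by
      rw [dvd_iff_isRoot, IsRoot.def, ← h0]
      simpa using eval_one_sub_of_comp_eq hP 0
    have hco : IsCoprime (X : ℝ[X]) (X - C 1) := ⟨1, -1, by simp⟩
    obtain ⟨Q, hQ⟩ := hco.mul_dvd hX h1
    have hQ' : P = (X ^ 2 - X) * Q := by rw [hQ, map_one]; ring
    have hsym : Q.comp (1 - X) = Q := comp_one_sub_cancel (by rw [← hQ']; exact hP)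
    have hdvd : X ^ r ∣ Q := by
      rw [hQ, pow_succ', mul_assoc, mul_dvd_mul_iff_left X_ne_zero] at hr
      exact (hco.pow_left (m := r)).dvd_of_dvd_mul_left hr
    obtain ⟨S, hS⟩ := ih Q hsym hdvd
    refine ⟨S, ?_⟩
    rw [hQ', pow_succ' _ r, mul_assoc, ← hS]

/-- If `P` is invariant under `x ↦ 1 - x` and agrees with `c x ^ r` up to order `r`, with `r` odd,
then it is `(x² - x) ^ r` times a polynomial in `x² - x` with constant term `-c`. -/
lemma exists_pow_mul_comp_of_symmetric_of_odd {r : ℕ} (hr : Odd r) {P W : ℝ[X]} {c : ℝ}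
    (hP : P.comp (1 - X) = P) (hPW : P = X ^ r * (C c + X * W)) (hP0 : P ≠ 0) :
    ∃ S : ℝ[X], P = (X ^ 2 - X) ^ r * S.comp (X ^ 2 - X) ∧ S.coeff 0 = -c ∧
      P.natDegree = 2 * r + 2 * S.natDegree := by
  obtain ⟨S, hS⟩ := exists_pow_mul_comp_of_symmetric r P hP ⟨_, hPW⟩
  refine ⟨S, hS, ?_, ?_⟩
  -- After cancelling `X ^ r`, evaluation at `0` leaves `(-1)^r S(0) = c`; oddness of `r` gives the
  -- sign.
  · have h1 : X ^ r * ((X - 1) ^ r * S.comp (X ^ 2 - X)) = X ^ r * (C c + X * W) := by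
      rw [← hPW, hS, ← mul_assoc, ← mul_pow]
      congr 2
      ring
    have h2 := congrArg (eval 0) (mul_left_cancel₀ (pow_ne_zero r X_ne_zero) h1)
    simp [eval_comp, hr.neg_one_pow] at h2
    rw [coeff_zero_eq_eval_zero]
    linarith
  · have hS0 : S.comp (X ^ 2 - X) ≠ 0 := by
      intro h; apply hP0; rw [hS, h, mul_zero]
    rw [hS, (X_sq_sub_X_monic.pow r).natDegree_mul' hS0, X_sq_sub_X_monic.natDegree_pow,
      natDegree_comp, X_sq_sub_X_natDegree]
    ring

/-! ### Antiderivatives of polynomials -/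

/-- The antiderivative of a polynomial vanishing at `0`. -/
def antideriv (p : ℝ[X]) : ℝ[X] :=
  p.sum fun i c => monomial (i + 1) (c / (i + 1))

lemma derivative_antideriv (p : ℝ[X]) : derivative (antideriv p) = p := by
  rw [antideriv, sum_def, derivative_sum]
  conv_rhs => rw [p.as_sum_support]
  refine Finset.sum_congr rfl fun i _ => ?_
  rw [derivative_monomial]
  congr 1
  push_cast
  field_simp

lemma coeff_antideriv_zero (p : ℝ[X]) : (antideriv p).coeff 0 = 0 := by
  rw [antideriv, sum_def, finsetSum_coeff]
  refine Finset.sum_eq_zero fun i _ => ?_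
  rw [coeff_monomial, if_neg (by omega)]

lemma coeff_antideriv_succ (p : ℝ[X]) (i : ℕ) :
    (antideriv p).coeff (i + 1) * (i + 1) = p.coeff i := by
  conv_rhs => rw [← derivative_antideriv p]
  rw [coeff_derivative]

lemma antideriv_ne_zero {p : ℝ[X]} (hp : p ≠ 0) : antideriv p ≠ 0 := by
  intro h
  apply hp
  rw [← derivative_antideriv p, h, derivative_zero]

lemma natDegree_antideriv {p : ℝ[X]} (hp : p ≠ 0) :
    (antideriv p).natDegree = p.natDegree + 1 := by
  apply natDegree_eq_of_le_of_coeff_ne_zero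
  · rw [natDegree_le_iff_coeff_eq_zero]
    intro N hN
    obtain ⟨i, rfl⟩ : ∃ i, N = i + 1 := ⟨N - 1, by omega⟩
    have h := coeff_antideriv_succ p i
    rw [coeff_eq_zero_of_natDegree_lt (p := p) (by omega)] at h
    exact (mul_eq_zero.mp h).resolve_right (by positivity)
  · intro h
    have h' := coeff_antideriv_succ p p.natDegree
    rw [h, zero_mul] at h'
    exact hp (leadingCoeff_eq_zero.mp h'.symm)

lemma X_pow_dvd_antideriv {p : ℝ[X]} {m : ℕ} (h : X ^ m ∣ p) : X ^ (m + 1) ∣ antideriv p := by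
  rw [X_pow_dvd_iff] at h ⊢
  rintro (_ | i) hi
  · exact coeff_antideriv_zero p
  · have h' := coeff_antideriv_succ p i
    rw [h i (by omega)] at h'
    exact (mul_eq_zero.mp h').resolve_right (by positivity)

lemma iterate_antideriv_ne_zero {p : ℝ[X]} (hp : p ≠ 0) (m : ℕ) : antideriv^[m] p ≠ 0 := by
  induction m with
  | zero => exact hp
  | succ m ih => rw [Function.iterate_succ_apply']; exact antideriv_ne_zero ih

lemma natDegree_iterate_antideriv {p : ℝ[X]} (hp : p ≠ 0) (m : ℕ) :
    (antideriv^[m] p).natDegree = p.natDegree + m := by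
  induction m with
  | zero => rfl
  | succ m ih =>
    rw [Function.iterate_succ_apply', natDegree_antideriv (iterate_antideriv_ne_zero hp m), ih,
      add_assoc]

lemma X_pow_dvd_iterate_antideriv (p : ℝ[X]) (m : ℕ) : X ^ m ∣ antideriv^[m] p := by
  induction m with
  | zero => simp
  | succ m ih => rw [Function.iterate_succ_apply']; exact X_pow_dvd_antideriv ih

/-! ### Functionals vanishing on polynomials of bounded degree -/

/-- One polynomial of each degree below `N` gives a triangular basis. Applied to an orthonormal
family and to the powers `(1 - x)^i`. -/
lemma linearMap_eq_zero_of_degree_lt (ℓ : ℝ[X] →ₗ[ℝ] ℝ) {p : ℕ → ℝ[X]} {N : ℕ}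
    (hdeg : ∀ i < N, (p i).degree = i) (hℓ : ∀ i < N, ℓ (p i) = 0) (q : ℝ[X])
    (hq : q.degree < N) : ℓ q = 0 := by
  induction N generalizing q with
  | zero =>
    have : q = 0 := by simpa [degree_lt_iff_coeff_zero, Polynomial.ext_iff] using hq
    simp [this]
  | succ N ih =>
    have hN := hdeg N (Nat.lt_succ_self N)
    have hnd : (p N).natDegree = N := natDegree_eq_of_degree_eq_some hN
    have hlead : (p N).coeff N ≠ 0 := by
      have h0 : p N ≠ 0 := by rintro h; rw [h, degree_zero] at hN; simp at hN
      have := leadingCoeff_ne_zero.mpr h0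
      rwa [leadingCoeff, hnd] at this
    set c := q.coeff N / (p N).coeff N with hc
    have key : ℓ (q - c • p N) = 0 := by
      refine ih (fun i hi => hdeg i (by omega)) (fun i hi => hℓ i (by omega)) _ ?_
      rw [degree_lt_iff_coeff_zero] at hq ⊢
      intro i hi
      rcases hi.eq_or_lt with rfl | hi
      · rw [coeff_sub, coeff_smul, smul_eq_mul, hc]; field_simp; ring
      · rw [coeff_sub, coeff_smul, hq i (by omega),
          coeff_eq_zero_of_natDegree_lt (p := p N) (by omega)]
        simp
    have := hℓ N (Nat.lt_succ_self N)
    rw [map_sub, map_smul, this] at key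
    simpa using key

/-! ### The real `L²` pairing on `[0,1]` -/

/-- Square integrability on `[0,1]`. -/
abbrev SqIntegrable (g : ℝ → ℝ) : Prop :=
  MemLp g 2 (volume.restrict (Icc (0 : ℝ) 1))

/-- The `L²` pairing on `[0,1]`. -/
def pairing (f g : ℝ → ℝ) : ℝ := ∫ x in (0 : ℝ)..1, f x * g x

lemma SqIntegrable.mul_intervalIntegrable {f g : ℝ → ℝ} (hf : SqIntegrable f)
    (hg : SqIntegrable g) : IntervalIntegrable (fun x => f x * g x) volume 0 1 := by
  rw [intervalIntegrable_iff_integrableOn_Icc_of_le zero_le_one]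
  exact hf.integrable_mul hg

lemma Continuous.sqIntegrable {g : ℝ → ℝ} (hg : Continuous g) : SqIntegrable g := by
  obtain ⟨C, hC⟩ := (isCompact_Icc (a := (0 : ℝ)) (b := 1)).exists_bound_of_continuousOn
    hg.continuousOn
  refine MemLp.of_bound hg.aestronglyMeasurable C ?_
  filter_upwards [ae_restrict_mem measurableSet_Icc] with x hx using hC x hx

lemma sqIntegrable_eval (q : ℝ[X]) : SqIntegrable fun x => q.eval x :=
  Continuous.sqIntegrable q.continuous

lemma pairing_comm (f g : ℝ → ℝ) : pairing f g = pairing g f := by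
  simp only [pairing, mul_comm]

lemma pairing_add_left {f g h : ℝ → ℝ} (hf : SqIntegrable f) (hg : SqIntegrable g)
    (hh : SqIntegrable h) :
    pairing (fun x => f x + g x) h = pairing f h + pairing g h := by
  simp only [pairing, add_mul]
  exact intervalIntegral.integral_add (hf.mul_intervalIntegrable hh) (hg.mul_intervalIntegrable hh)

lemma pairing_sub_left {f g h : ℝ → ℝ} (hf : SqIntegrable f) (hg : SqIntegrable g)
    (hh : SqIntegrable h) :
    pairing (fun x => f x - g x) h = pairing f h - pairing g h := by
  simp only [pairing, sub_mul]
  exact intervalIntegral.integral_sub (hf.mul_intervalIntegrable hh) (hg.mul_intervalIntegrable hh)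

lemma pairing_const_mul_left (c : ℝ) (f h : ℝ → ℝ) :
    pairing (fun x => c * f x) h = c * pairing f h := by
  simp only [pairing, mul_assoc]
  exact intervalIntegral.integral_const_mul _ _

lemma pairing_self_nonneg (f : ℝ → ℝ) : 0 ≤ pairing f f :=
  intervalIntegral.integral_nonneg zero_le_one fun _ _ => mul_self_nonneg _

/-- If `∫ g² ≤ 1`, then `(∫ f g)² ≤ ∫ f²`. -/
lemma sq_pairing_le {f g : ℝ → ℝ} (hf : SqIntegrable f) (hg : SqIntegrable g)
    (h1 : pairing g g ≤ 1) : pairing f g ^ 2 ≤ pairing f f := by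
  set s := pairing f g with hs
  have hsg : SqIntegrable fun x => s * g x := hg.const_mul s
  have hfs : SqIntegrable fun x => f x - s * g x := hf.sub hsg
  -- Expanded, this reads `0 ≤ ⟨f, f⟩ - 2s² + s²⟨g, g⟩`.
  have h := pairing_self_nonneg fun x => f x - s * g x
  rw [pairing_sub_left hf hsg hfs, pairing_const_mul_left, pairing_comm f,
    pairing_comm g, pairing_sub_left hf hsg hf, pairing_sub_left hf hsg hg,
    pairing_const_mul_left, pairing_const_mul_left, pairing_comm g f, ← hs] at h
  nlinarith [sq_nonneg s]

/-- Pairing of polynomials against a fixed square integrable function. -/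
def moment (g : ℝ → ℝ) (hg : SqIntegrable g) : ℝ[X] →ₗ[ℝ] ℝ where
  toFun q := pairing (fun x => q.eval x) g
  map_add' p q := by
    simp only [eval_add]
    exact pairing_add_left (sqIntegrable_eval p) (sqIntegrable_eval q) hg
  map_smul' c p := by
    simp only [eval_smul, smul_eq_mul, RingHom.id_apply]
    exact pairing_const_mul_left _ _ _

@[simp]
lemma moment_apply (g : ℝ → ℝ) (hg : SqIntegrable g) (q : ℝ[X]) :
    moment g hg q = pairing (fun x => q.eval x) g := rfl

lemma pairing_eval_self_pos {q : ℝ[X]} (hq : q ≠ 0) :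
    0 < pairing (fun x => q.eval x) (fun x => q.eval x) := by
  obtain ⟨c, hc, hcq⟩ : ∃ c ∈ Icc (0 : ℝ) 1, q.eval c ≠ 0 := by
    by_contra! h
    exact hq (eq_zero_of_infinite_isRoot q ((Icc_infinite zero_lt_one).mono h))
  exact intervalIntegral.integral_pos zero_lt_one
    (q.continuous.mul q.continuous).continuousOn (fun _ _ => mul_self_nonneg _)
    ⟨c, hc, mul_self_pos.mpr hcq⟩

/-- Orthonormal polynomials of degrees `0, …, N - 1`. -/
lemma exists_orthonormal_polynomials (N : ℕ) :
    ∃ p : ℕ → ℝ[X], (∀ i < N, (p i).degree = i) ∧ ∀ i < N, ∀ j < N,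
      pairing (fun x => (p i).eval x) (fun x => (p j).eval x) = if i = j then 1 else 0 := by
  induction N with
  | zero => exact ⟨0, by simp, by simp⟩
  | succ N ih =>
    obtain ⟨p, hdeg, horth⟩ := ih
    -- Gram–Schmidt: `s` is the projection of `X ^ N` onto the span of the earlier `p i`.
    set s : ℝ[X] := ∑ i ∈ Finset.range N,
      pairing (fun x => (X ^ N : ℝ[X]).eval x) (fun x => (p i).eval x) • p i with hs
    set q : ℝ[X] := X ^ N - s with hq
    have hsdeg : s.degree < (N : WithBot ℕ) := by
      refine (degree_sum_le _ _).trans_lt ((Finset.sup_lt_iff (WithBot.bot_lt_coe N)).mpr ?_)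
      intro i hi
      refine (degree_smul_le _ _).trans_lt ?_
      rw [hdeg i (Finset.mem_range.mp hi)]
      exact Nat.cast_lt.mpr (Finset.mem_range.mp hi)
    have hqdeg : q.degree = N := by
      rw [hq, degree_sub_eq_left_of_degree_lt] <;> simp [hsdeg]
    have hq0 : q ≠ 0 := by
      rintro h; rw [h, degree_zero] at hqdeg; simp at hqdeg
    have hqp : ∀ j < N, pairing (fun x => q.eval x) (fun x => (p j).eval x) = 0 := by
      intro j hj
      rw [← moment_apply _ (sqIntegrable_eval (p j)), hq, map_sub, hs, map_sum]
      rw [Finset.sum_eq_single_of_mem j (Finset.mem_range.mpr hj)]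
      · simp only [map_smul, moment_apply, horth j hj j hj]
        simp
      · intro i hi hij
        simp only [map_smul, moment_apply, horth i (Finset.mem_range.mp hi) j hj, if_neg hij]
        simp
    have hpos := pairing_eval_self_pos hq0
    set L := pairing (fun x => q.eval x) (fun x => q.eval x) with hL
    set e : ℝ := (√L)⁻¹ with he
    have he0 : e ≠ 0 := by positivity
    have hee : e * (e * L) = 1 := by
      rw [he]; nth_rewrite 3 [← Real.mul_self_sqrt hpos.le]
      have : √L ≠ 0 := by positivity
      field_simp
    refine ⟨Function.update p N (C e * q), ?_, ?_⟩
    · intro i hi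
      rcases Nat.lt_succ_iff_lt_or_eq.mp hi with hi | rfl
      · rw [Function.update_of_ne hi.ne]; exact hdeg i hi
      · rw [Function.update_self, degree_C_mul he0, hqdeg]
    · intro i hi j hj
      rcases Nat.lt_succ_iff_lt_or_eq.mp hi with hi | rfl <;>
      rcases Nat.lt_succ_iff_lt_or_eq.mp hj with hj | rfl
      · rw [Function.update_of_ne hi.ne, Function.update_of_ne hj.ne]; exact horth i hi j hj
      · rw [Function.update_of_ne hi.ne, Function.update_self, if_neg hi.ne]
        simp only [eval_mul, eval_C]
        rw [pairing_comm, pairing_const_mul_left, hqp i hi, mul_zero]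
      · rw [Function.update_of_ne hj.ne, Function.update_self, if_neg hj.ne']
        simp only [eval_mul, eval_C]
        rw [pairing_const_mul_left, hqp j hj, mul_zero]
      · rw [Function.update_self, if_pos rfl]
        simp only [eval_mul, eval_C]
        rw [pairing_const_mul_left, pairing_comm, pairing_const_mul_left, ← hL, hee]

/-! ### Iterated primitives -/

/-- If `v 0, v 1, …, v M` is a chain of successive primitives vanishing at `0`, then `v (d + 1)` is
given by Cauchy's formula for repeated integration. -/
lemma eq_integral_of_primitives {M : ℕ} {v : ℕ → ℝ → ℝ}
    (hac : ∀ i < M, AbsolutelyContinuousOnInterval (v (i + 1)) 0 1)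
    (h0 : ∀ i < M, v (i + 1) 0 = 0)
    (hd : ∀ i < M, ∀ᵐ x, x ∈ Icc (0 : ℝ) 1 → deriv (v (i + 1)) x = v i x)
    {d : ℕ} (hdM : d < M) {a : ℝ} (ha : a ∈ Icc (0 : ℝ) 1) :
    v (d + 1) a = ∫ x in (0 : ℝ)..a, (a - x) ^ d / d.factorial * v 0 x := by
  have hsub : uIcc 0 a ⊆ uIcc (0 : ℝ) 1 := by
    rw [uIcc_of_le ha.1, uIcc_of_le zero_le_one]; exact Icc_subset_Icc_right ha.2
  have hcongr : ∀ (i : ℕ) (w : ℝ → ℝ), i < M →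
      ∫ x in (0 : ℝ)..a, w x * v i x = ∫ x in (0 : ℝ)..a, w x * deriv (v (i + 1)) x := by
    intro i w hi
    refine intervalIntegral.integral_congr_ae ?_
    filter_upwards [hd i hi] with x hx hxa
    rw [hx]
    rw [uIoc_of_le ha.1] at hxa
    exact ⟨hxa.1.le, hxa.2.trans ha.2⟩
  induction d generalizing v M with
  | zero =>
    rw [hcongr 0 _ hdM]
    simp [((hac 0 hdM).mono hsub).integral_deriv_eq_sub, h0 0 hdM]
  | succ d ih =>
    -- The induction hypothesis is used on the chain starting at `v 1`. Integration by parts then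
    -- passes to `v 0`; the boundary terms vanish because `(a - x)^(d+1)` is zero at `a` and `v 1`
    -- is zero at `0`.
    obtain ⟨M, rfl⟩ : ∃ M', M = M' + 1 := ⟨M - 1, by omega⟩
    have key := ih (M := M) (v := fun i => v (i + 1)) (fun i hi => hac (i + 1) (by omega))
      (fun i hi => h0 (i + 1) (by omega)) (fun i hi => hd (i + 1) (by omega)) (by omega)
      (fun i w hi => hcongr (i + 1) w (by omega))
    rw [key, hcongr 0 _ (by omega)]
    have hw : ∀ x : ℝ, HasDerivAt (fun x => (a - x) ^ (d + 1) / ((d + 1).factorial : ℝ))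
        (-((a - x) ^ d / (d.factorial : ℝ))) x := by
      intro x
      have h := (((hasDerivAt_id x).const_sub a).fun_pow (d + 1)).div_const ((d + 1).factorial : ℝ)
      refine h.congr_deriv ?_
      rw [Nat.factorial_succ]
      push_cast
      simp
      field_simp
    have hwac : AbsolutelyContinuousOnInterval
        (fun x => (a - x) ^ (d + 1) / ((d + 1).factorial : ℝ)) 0 a := by
      apply ContDiffOn.absolutelyContinuousOnInterval
      apply ContDiff.contDiffOn
      fun_prop
    rw [hwac.integral_mul_deriv_eq_deriv_mul ((hac 0 (by omega)).mono hsub)]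
    simp only [(hw _).deriv, h0 0 (by omega)]
    simp

/-- The truncated power `(a - x)₊ ^ d / d!`. -/
def truncPow (d : ℕ) (a x : ℝ) : ℝ := if x < a then (a - x) ^ d / d.factorial else 0

lemma truncPow_eq_indicator (d : ℕ) (a : ℝ) :
    truncPow d a = (Iio a).indicator fun x => (a - x) ^ d / (d.factorial : ℝ) := by
  ext x; simp [truncPow, indicator]

lemma sqIntegrable_truncPow (d : ℕ) (a : ℝ) : SqIntegrable (truncPow d a) := by
  have h : SqIntegrable fun x => (a - x) ^ d / (d.factorial : ℝ) :=
    Continuous.sqIntegrable (by fun_prop)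
  rw [truncPow_eq_indicator]
  exact h.indicator measurableSet_Iio

lemma pairing_truncPow (d : ℕ) {a : ℝ} (ha : a ∈ Icc (0 : ℝ) 1) {g : ℝ → ℝ}
    (hg : SqIntegrable g) :
    pairing (truncPow d a) g = ∫ x in (0 : ℝ)..a, (a - x) ^ d / d.factorial * g x := by
  have hint := (sqIntegrable_truncPow d a).mul_intervalIntegrable hg
  have ha' : a ∈ uIcc (0 : ℝ) 1 := by rwa [uIcc_of_le zero_le_one]
  rw [pairing, ← intervalIntegral.integral_add_adjacent_intervals
    (hint.mono_set (uIcc_subset_uIcc left_mem_uIcc ha'))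
    (hint.mono_set (uIcc_subset_uIcc ha' right_mem_uIcc))]
  have h2 : ∫ x in a..1, truncPow d a x * g x = 0 := by
    rw [intervalIntegral.integral_congr (g := fun _ => (0 : ℝ))]
    · simp
    · intro x hx
      rw [uIcc_of_le ha.2] at hx
      simp [truncPow, not_lt.mpr hx.1]
  rw [h2, add_zero]
  refine intervalIntegral.integral_congr_ae ?_
  have hne : ∀ᵐ x : ℝ, x ≠ a := by simp [ae_iff, measure_singleton]
  filter_upwards [hne] with x hx hxa
  rw [uIoc_of_le ha.1] at hxa
  rw [truncPow, if_pos (lt_of_le_of_ne hxa.2 hx)]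

lemma pairing_truncPow_self (d : ℕ) {a : ℝ} (ha : a ∈ Icc (0 : ℝ) 1) :
    pairing (truncPow d a) (truncPow d a) =
      1 / ((2 * d + 1) * (d.factorial : ℝ) ^ 2) * a ^ (2 * d + 1) := by
  rw [pairing_truncPow d ha (sqIntegrable_truncPow d a)]
  have h : ∫ x in (0 : ℝ)..a, (a - x) ^ d / d.factorial * truncPow d a x =
      ∫ x in (0 : ℝ)..a, (fun y => y ^ (2 * d) / (d.factorial : ℝ) ^ 2) (a - x) := by
    refine intervalIntegral.integral_congr_ae ?_
    have hne : ∀ᵐ x : ℝ, x ≠ a := by simp [ae_iff, measure_singleton]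
    filter_upwards [hne] with x hx hxa
    rw [uIoc_of_le ha.1] at hxa
    rw [truncPow, if_pos (lt_of_le_of_ne hxa.2 hx)]
    ring
  rw [h, intervalIntegral.integral_comp_sub_left (fun y => y ^ (2 * d) / (d.factorial : ℝ) ^ 2)]
  simp
  field_simp

/-- Cauchy's formula for the chain of antiderivatives of `p`. It makes the coefficients of the
projection polynomial in `a`. -/
lemma pairing_truncPow_eval (d : ℕ) {a : ℝ} (ha : a ∈ Icc (0 : ℝ) 1) (p : ℝ[X]) :
    pairing (truncPow d a) (fun x => p.eval x) = (antideriv^[d + 1] p).eval a := by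
  rw [pairing_truncPow d ha (sqIntegrable_eval p)]
  symm
  refine eq_integral_of_primitives (M := d + 1) (v := fun i x => (antideriv^[i] p).eval x)
    ?_ ?_ ?_ (Nat.lt_succ_self d) ha
  · intro i _
    apply ContDiffOn.absolutelyContinuousOnInterval
    exact (by simpa using (antideriv^[i + 1] p).contDiff_aeval (𝕜 := ℝ) 1 :
      ContDiff ℝ 1 fun x => (antideriv^[i + 1] p).eval x).contDiffOn
  · intro i _
    rw [Function.iterate_succ_apply', ← coeff_zero_eq_eval_zero, coeff_antideriv_zero]
  · intro i _
    refine Filter.Eventually.of_forall fun x _ => ?_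
    rw [Polynomial.deriv, Function.iterate_succ_apply', derivative_antideriv]

/-! ### The distance from a truncated power to the polynomials of bounded degree -/

/-- `q` is the `L²` projection of the truncated power onto the polynomials of degree less than `N`. -/
structure IsProjection (N d : ℕ) (a : ℝ) (q : ℝ[X]) : Prop where
  degree_lt : q.degree < N
  orthogonal : ∀ r : ℝ[X], r.degree < N →
    pairing (fun x => r.eval x) (fun x => truncPow d a x - q.eval x) = 0

lemma sqIntegrable_truncPow_sub (d : ℕ) (a : ℝ) (q : ℝ[X]) :
    SqIntegrable fun x => truncPow d a x - q.eval x :=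
  (sqIntegrable_truncPow d a).sub (sqIntegrable_eval q)

lemma IsProjection.pairing_truncPow_left {N d : ℕ} {a : ℝ} {q : ℝ[X]} (h : IsProjection N d a q) :
    pairing (truncPow d a) (fun x => truncPow d a x - q.eval x) =
      pairing (fun x => truncPow d a x - q.eval x) (fun x => truncPow d a x - q.eval x) := by
  rw [pairing_sub_left (sqIntegrable_truncPow d a) (sqIntegrable_eval q)
    (sqIntegrable_truncPow_sub d a q), h.orthogonal q h.degree_lt, sub_zero]

/-- The projection minimises the distance. -/
lemma IsProjection.pairing_le {N d : ℕ} {a : ℝ} {q : ℝ[X]} (h : IsProjection N d a q)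
    {r : ℝ[X]} (hr : r.degree < N) :
    pairing (fun x => truncPow d a x - q.eval x) (fun x => truncPow d a x - q.eval x) ≤
      pairing (fun x => truncPow d a x - r.eval x) (fun x => truncPow d a x - r.eval x) := by
  have hG := sqIntegrable_truncPow_sub d a q
  have hs := sqIntegrable_eval (q - r)
  have hGs : SqIntegrable fun x => (truncPow d a x - q.eval x) + (q - r).eval x := hG.add hs
  have hdecomp : (fun x => truncPow d a x - r.eval x) =
      fun x => (truncPow d a x - q.eval x) + (q - r).eval x := by
    ext x; rw [eval_sub]; ring
  have horth := h.orthogonal (q - r) ((degree_sub_le _ _).trans_lt (max_lt h.degree_lt hr))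
  rw [hdecomp, pairing_add_left hG hs hGs, pairing_comm _ (fun x => _ + _),
    pairing_comm (fun x => (q - r).eval x) (fun x => _ + _),
    pairing_add_left hG hs hG, pairing_add_left hG hs hs, horth,
    pairing_comm _ (fun x => (q - r).eval x), horth]
  linarith [pairing_self_nonneg fun x => (q - r).eval x]

/-- Reflection `x ↦ 1 - x` turns the truncated power at `1 - a` into the one at `a`, up to sign and
a polynomial. -/
lemma pairing_truncPow_reflect {N d : ℕ} (hd : d < N) (a : ℝ) {q : ℝ[X]} (hq : q.degree < N) :
    ∃ r : ℝ[X], r.degree < N ∧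
      pairing (fun x => truncPow d (1 - a) x - q.eval x)
        (fun x => truncPow d (1 - a) x - q.eval x) =
      pairing (fun x => truncPow d a x - r.eval x) (fun x => truncPow d a x - r.eval x) := by
  -- Comes from `(x - a)₊^d = (x - a)^d - (-1)^d (a - x)₊^d` for `x ≠ a`; since `d < N`, the term
  -- `(x - a)^d` is an admissible polynomial.
  set w : ℝ[X] := C ((-1) ^ d) *
    (C (1 / (d.factorial : ℝ)) * (X - C a) ^ d - q.comp (1 - X)) with hw
  refine ⟨w, ?_, ?_⟩
  · rw [hw]
    rw [degree_C_mul (pow_ne_zero d (by norm_num))]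
    refine (degree_sub_le _ _).trans_lt (max_lt ?_ ?_)
    · rw [degree_C_mul (by positivity), degree_pow, degree_X_sub_C, nsmul_one]
      exact Nat.cast_lt.mpr hd
    · by_cases hq0 : q = 0
      · simp [hq0]
      · refine degree_le_natDegree.trans_lt (Nat.cast_lt.mpr ?_)
        refine natDegree_comp_le.trans_lt ?_
        have h1 : (1 - X : ℝ[X]).natDegree ≤ 1 := by compute_degree
        have h2 : q.natDegree < N := (natDegree_lt_iff_degree_lt hq0).mpr hq
        nlinarith
  · have href : pairing (fun x => truncPow d (1 - a) x - q.eval x)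
        (fun x => truncPow d (1 - a) x - q.eval x) =
        ∫ x in (0 : ℝ)..1, (fun y => (truncPow d (1 - a) y - q.eval y) *
          (truncPow d (1 - a) y - q.eval y)) (1 - x) := by
      rw [intervalIntegral.integral_comp_sub_left (fun y => (truncPow d (1 - a) y - q.eval y) *
          (truncPow d (1 - a) y - q.eval y))]
      simp [pairing]
    rw [href, pairing]
    refine intervalIntegral.integral_congr_ae ?_
    have hne : ∀ᵐ x : ℝ, x ≠ a := by simp [ae_iff, measure_singleton]
    filter_upwards [hne] with x hx _
    have hsq : ((-1 : ℝ) ^ d) * (-1) ^ d = 1 := by rw [← mul_pow]; simp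
    have key : truncPow d (1 - a) (1 - x) - q.eval (1 - x) =
        -(-1) ^ d * (truncPow d a x - w.eval x) := by
      have hpow : (x - a) ^ d = (-1) ^ d * (a - x) ^ d := by rw [← mul_pow]; ring
      have hw' : w.eval x =
          (-1) ^ d * (1 / (d.factorial : ℝ) * (x - a) ^ d - q.eval (1 - x)) := by
        simp [hw, eval_comp]
      rw [hw']
      simp only [truncPow]
      rcases lt_or_gt_of_ne hx with h | h
      · rw [if_neg (by linarith), if_pos h, hpow]
        linear_combination (q.eval (1 - x) - (a - x) ^ d / (d.factorial : ℝ) * (-1) ^ d) * hsq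
      · rw [if_pos (by linarith), if_neg (by linarith)]
        have : 1 - a - (1 - x) = x - a := by ring
        rw [this]
        linear_combination (q.eval (1 - x) - (x - a) ^ d / (d.factorial : ℝ)) * hsq
    simp only [key]
    linear_combination (truncPow d a x - w.eval x) ^ 2 * hsq

/-- The squared distance from the truncated power at `a` to the polynomials of degree less than
`N`, as a polynomial in `a`. -/
lemma exists_distance_polynomial {N d : ℕ} (hd : d < N) :
    ∃ P W : ℝ[X], P.natDegree = 2 * (N + d) ∧
      P = X ^ (2 * d + 1) * (C (1 / ((2 * d + 1) * (d.factorial : ℝ) ^ 2)) + X * W) ∧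
      P.comp (1 - X) = P ∧
      ∀ a ∈ Icc (0 : ℝ) 1, ∃ q : ℝ[X], IsProjection N d a q ∧
        pairing (fun x => truncPow d a x - q.eval x) (fun x => truncPow d a x - q.eval x) =
          P.eval a := by
  obtain ⟨p, hdeg, horth⟩ := exists_orthonormal_polynomials N
  have hp0 : ∀ i < N, p i ≠ 0 := by
    intro i hi h
    have := hdeg i hi
    rw [h, degree_zero] at this
    simp at this
  have hnd : ∀ i < N, (p i).natDegree = i := fun i hi => natDegree_eq_of_degree_eq_some (hdeg i hi)
  choose V hV using fun i => X_pow_dvd_iterate_antideriv (p i) (d + 1)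
  set c : ℝ := 1 / ((2 * d + 1) * (d.factorial : ℝ) ^ 2) with hc
  set P : ℝ[X] := C c * X ^ (2 * d + 1) - ∑ i ∈ Finset.range N, (antideriv^[d + 1] (p i)) ^ 2 with hP
  have hproj : ∀ a ∈ Icc (0 : ℝ) 1, ∃ q : ℝ[X], IsProjection N d a q ∧
      pairing (fun x => truncPow d a x - q.eval x) (fun x => truncPow d a x - q.eval x) =
        P.eval a := by
    intro a ha
    have hφ := sqIntegrable_truncPow d a
    set q : ℝ[X] := ∑ i ∈ Finset.range N, (antideriv^[d + 1] (p i)).eval a • p i with hq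
    have hqpair : ∀ g (hg : SqIntegrable g), pairing (fun x => q.eval x) g =
        ∑ i ∈ Finset.range N,
          (antideriv^[d + 1] (p i)).eval a * pairing (fun x => (p i).eval x) g := by
      intro g hg
      rw [← moment_apply g hg, hq, map_sum]
      simp only [map_smul, moment_apply, smul_eq_mul]
    have hq_proj : IsProjection N d a q := by
      constructor
      · refine (degree_sum_le _ _).trans_lt ((Finset.sup_lt_iff (WithBot.bot_lt_coe N)).mpr ?_)
        intro i hi
        refine (degree_smul_le _ _).trans_lt ?_
        rw [hdeg i (Finset.mem_range.mp hi)]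
        exact Nat.cast_lt.mpr (Finset.mem_range.mp hi)
      · intro r hr
        rw [← moment_apply _ (sqIntegrable_truncPow_sub d a q)]
        refine linearMap_eq_zero_of_degree_lt _ hdeg (fun j hj => ?_) r hr
        rw [moment_apply, pairing_comm, pairing_sub_left hφ (sqIntegrable_eval q)
          (sqIntegrable_eval _), pairing_truncPow_eval d ha, hqpair _ (sqIntegrable_eval _),
          Finset.sum_eq_single_of_mem j (Finset.mem_range.mpr hj)]
        · rw [horth j hj j hj]; simp
        · intro i hi hij
          rw [horth i (Finset.mem_range.mp hi) j hj, if_neg hij, mul_zero]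
    refine ⟨q, hq_proj, ?_⟩
    -- Pythagoras: the squared distance is `⟨φ, φ⟩ - ⟨q, φ⟩`, and `⟨q, φ⟩` is the sum of the squared
    -- coefficients.
    rw [← hq_proj.pairing_truncPow_left, pairing_comm, pairing_sub_left hφ (sqIntegrable_eval q) hφ,
      pairing_truncPow_self d ha, hqpair _ hφ]
    simp only [pairing_comm _ (truncPow d a), pairing_truncPow_eval d ha]
    simp [hP, eval_finsetSum, hc, sq]
  refine ⟨P, -∑ i ∈ Finset.range N, V i ^ 2, ?_, ?_, ?_, hproj⟩
  · obtain ⟨M, rfl⟩ : ∃ M, N = M + 1 := ⟨N - 1, by omega⟩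
    have hsq : ∀ i < M + 1, ((antideriv^[d + 1] (p i)) ^ 2).natDegree = 2 * (i + (d + 1)) := by
      intro i hi
      rw [natDegree_pow, natDegree_iterate_antideriv (hp0 i hi), hnd i hi]
    set R : ℝ[X] := C c * X ^ (2 * d + 1) -
      ∑ i ∈ Finset.range M, (antideriv^[d + 1] (p i)) ^ 2 with hR
    have hPR : P = R - (antideriv^[d + 1] (p M)) ^ 2 := by
      rw [hP, Finset.sum_range_succ, hR]; ring
    have hlt : R.natDegree < ((antideriv^[d + 1] (p M)) ^ 2).natDegree := by
      rw [hsq M (by omega)]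
      refine (natDegree_sub_le _ _).trans_lt (max_lt ?_ ?_)
      · refine (natDegree_C_mul_X_pow_le _ _).trans_lt (by omega)
      · refine Nat.lt_of_le_pred (by omega) ?_
        refine natDegree_sum_le_of_forall_le _ _ fun i hi => ?_
        have := Finset.mem_range.mp hi
        rw [hsq i (by omega), Nat.pred_eq_sub_one]
        omega
    rw [hPR, natDegree_sub_eq_right_of_natDegree_lt hlt, hsq M (by omega)]
    ring
  · rw [hP]
    simp only [hV, mul_pow, ← Finset.mul_sum]
    ring
  -- The reflected best approximation at `1 - a` is a competitor at `a`; exchanging `a` and `1 - a`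
  -- yields equality.
  · have hle : ∀ a ∈ Icc (0 : ℝ) 1, P.eval a ≤ P.eval (1 - a) := by
      intro a ha
      obtain ⟨q, hq, hqP⟩ := hproj a ha
      obtain ⟨q', hq', hqP'⟩ := hproj (1 - a) ⟨by linarith [ha.2], by linarith [ha.1]⟩
      obtain ⟨r, hr, hrq⟩ := pairing_truncPow_reflect hd a hq'.degree_lt
      rw [← hqP, ← hqP', hrq]
      exact hq.pairing_le hr
    apply eq_of_infinite_eval_eq
    refine (Icc_infinite (zero_lt_one (α := ℝ))).mono fun a ha => ?_
    have h2 := hle (1 - a) ⟨by linarith [ha.2], by linarith [ha.1]⟩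
    rw [sub_sub_cancel] at h2
    simpa [eval_comp] using le_antisymm h2 (hle a ha)

/-! ### The upper bound -/

lemma AbsolutelyContinuousOnInterval.of_dist_le {E F : Type*} [PseudoMetricSpace E]
    [PseudoMetricSpace F] {f : ℝ → E} {g : ℝ → F} {a b : ℝ}
    (hf : AbsolutelyContinuousOnInterval f a b)
    (h : ∀ x ∈ uIcc a b, ∀ y ∈ uIcc a b, dist (g x) (g y) ≤ dist (f x) (f y)) :
    AbsolutelyContinuousOnInterval g a b := by
  rw [absolutelyContinuousOnInterval_iff] at hf ⊢
  intro ε hε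
  obtain ⟨δ, hδ, H⟩ := hf ε hε
  refine ⟨δ, hδ, fun E hE hlt => (Finset.sum_le_sum fun i hi => ?_).trans_lt (H E hE hlt)⟩
  exact h _ (hE.1 i hi).1 _ (hE.1 i hi).2

variable {𝕜 : Type*} [RCLike 𝕜]

/-- Absolute continuity gives bounded variation, hence differentiability almost everywhere; at
interior points the derivative within `[0,1]` is the ordinary one. -/
lemma MemH.ae_hasDerivAt {n : ℕ} {f : ℝ → 𝕜} (hf : MemH n f) {j : ℕ} (hj : j < n) :
    ∀ᵐ x, x ∈ Icc (0 : ℝ) 1 → HasDerivAt (D j f) (D (j + 1) f x) x := by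
  have h0 : ∀ᵐ x : ℝ, x ≠ 0 := by simp [ae_iff, measure_singleton]
  have h1 : ∀ᵐ x : ℝ, x ≠ 1 := by simp [ae_iff, measure_singleton]
  have hd := (hf.absolutelyContinuous j hj).boundedVariationOn.ae_differentiableAt_of_mem_uIcc
  rw [uIcc_of_le zero_le_one] at hd
  filter_upwards [h0, h1, hd] with x hx0 hx1 hx hmem
  have hnhds : Icc (0 : ℝ) 1 ∈ nhds x :=
    Icc_mem_nhds (lt_of_le_of_ne hmem.1 (Ne.symm hx0)) (lt_of_le_of_ne hmem.2 hx1)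
  have h := (hx hmem).hasDerivAt
  rwa [← derivWithin_of_mem_nhds hnhds, ← iteratedDerivWithin_succ] at h

/-- The value of a derivative at a point is at most the distance from the truncated power to the
polynomials of degree less than `n`. -/
lemma MemH.sq_norm_le {k d : ℕ} {f : ℝ → 𝕜} (hf : MemH (k + d + 1) f)
    (hnorm : normH (k + d + 1) f ≤ 1) {a : ℝ} (ha : a ∈ Icc (0 : ℝ) 1) {q : ℝ[X]}
    (hq : q.degree < (k + d + 1 : ℕ)) :
    ‖D k f a‖ ^ 2 ≤
      pairing (fun x => truncPow d a x - q.eval x) (fun x => truncPow d a x - q.eval x) := by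
  set n := k + d + 1 with hn
  -- Rotating by a unimodular `c` and taking real parts reduces to the real case: the value at `a`
  -- becomes its norm, and no norm grows.
  obtain ⟨c, hc1, hc⟩ : ∃ c : 𝕜, ‖c‖ = 1 ∧ ↑‖D k f a‖ = c * D k f a :=
    RCLike.exists_norm_eq_mul_self _
  set u : ℕ → ℝ → ℝ := fun j x => RCLike.re (c * D j f x) with hu
  have hu0 : ∀ j < n, u j 0 = 0 := fun j hj => by
    simp only [hu, hf.left_eq_zero j hj]; simp
  have hu1 : ∀ j < n, u j 1 = 0 := fun j hj => by
    simp only [hu, hf.right_eq_zero j hj]; simp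
  have hule : ∀ z : 𝕜, |RCLike.re (c * z)| ≤ ‖z‖ := fun z => by
    simpa [hc1] using RCLike.abs_re_le_norm (c * z)
  have huac : ∀ j < n, AbsolutelyContinuousOnInterval (u j) 0 1 := by
    intro j hj
    refine AbsolutelyContinuousOnInterval.of_dist_le (hf.absolutelyContinuous j hj) ?_
    intro x _ y _
    rw [Real.dist_eq, dist_eq_norm]
    simpa [hu, mul_sub] using hule (D j f x - D j f y)
  have hud : ∀ j < n, ∀ᵐ x, x ∈ Icc (0 : ℝ) 1 → deriv (u j) x = u (j + 1) x := by
    intro j hj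
    filter_upwards [hf.ae_hasDerivAt hj] with x hx hmem
    exact (RCLike.reCLM.hasFDerivAt.comp_hasDerivAt x ((hx hmem).const_mul c)).deriv
  have hsq : SqIntegrable (u n) := (hf.memLp.const_mul c).re
  have hle1 : pairing (u n) (u n) ≤ 1 := by
    have h2 : ∫ x in Icc (0 : ℝ) 1, ‖D n f x‖ ^ 2 ≤ 1 := by
      exact Real.sqrt_le_one.mp hnorm
    refine le_trans ?_ h2
    rw [pairing, intervalIntegral.integral_of_le zero_le_one, ← integral_Icc_eq_integral_Ioc]
    refine integral_mono (hsq.integrable_mul hsq)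
      ((memLp_two_iff_integrable_sq_norm hf.memLp.1).mp hf.memLp) fun x => ?_
    change u n x * u n x ≤ ‖D n f x‖ ^ 2
    rw [← sq, ← sq_abs]
    exact pow_le_pow_left₀ (abs_nonneg _) (hule _) 2
  have hrep : ∀ i < n, ∀ b ∈ Icc (0 : ℝ) 1, u (n - (i + 1)) b = pairing (truncPow i b) (u n) := by
    intro i hi b hb
    rw [pairing_truncPow i hb hsq]
    -- The chain of primitives runs upwards from the top derivative, so the indices are reversed.
    refine eq_integral_of_primitives (M := n) (v := fun i => u (n - i)) (fun i hi => ?_)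
      (fun i hi => ?_) (fun i hi => ?_) hi hb
    · exact huac _ (by omega)
    · exact hu0 _ (by omega)
    · have := hud (n - (i + 1)) (by omega)
      rwa [show n - (i + 1) + 1 = n - i by omega] at this
  have hmom : pairing (fun x => q.eval x) (u n) = 0 := by
    rw [← moment_apply _ hsq]
    -- At the point `1` the representation `hrep` turns the right boundary values into vanishing
    -- moments of `(1 - x)^i` for `i < n`.
    refine linearMap_eq_zero_of_degree_lt (p := fun i => (C 1 - X) ^ i) (N := n) _ ?_ ?_ q hq
    · intro i _
      have h : (C 1 - X : ℝ[X]).degree = 1 := by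
        rw [← degree_neg, neg_sub, degree_X_sub_C]
      rw [degree_pow, h]; simp
    · intro i hi
      have h := hrep i hi 1 (right_mem_Icc.mpr zero_le_one)
      rw [hu1 _ (by omega), pairing_truncPow i (right_mem_Icc.mpr zero_le_one) hsq] at h
      have h' : pairing (fun x => ((C 1 - X : ℝ[X]) ^ i).eval x) (u n) =
          i.factorial * ∫ x in (0 : ℝ)..1, (1 - x) ^ i / i.factorial * u n x := by
        rw [pairing, ← intervalIntegral.integral_const_mul]
        congr 1
        ext x
        simp
        field_simp
      rw [moment_apply, h', ← h, mul_zero]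
  have hval : ‖D k f a‖ = pairing (fun x => truncPow d a x - q.eval x) (u n) := by
    rw [pairing_sub_left (sqIntegrable_truncPow d a) (sqIntegrable_eval q) hsq, hmom, sub_zero,
      ← hrep d (by omega) a ha, show n - (d + 1) = k by omega]
    simp only [hu, ← hc]
    simp
  rw [hval]
  exact sq_pairing_le (sqIntegrable_truncPow_sub d a q) hsq hle1

/-! ### The extremal function -/

/-- The primitive vanishing at `0`. -/
def primitive (g : ℝ → ℝ) (x : ℝ) : ℝ := ∫ t in (0 : ℝ)..x, g t

lemma continuous_iterate_primitive {g : ℝ → ℝ} (hg : ∀ a b, IntervalIntegrable g volume a b)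
    (i : ℕ) : Continuous (primitive^[i + 1] g) := by
  induction i with
  | zero => exact intervalIntegral.continuous_primitive hg 0
  | succ i ih =>
    rw [Function.iterate_succ_apply']
    exact intervalIntegral.continuous_primitive (fun a b => ih.intervalIntegrable a b) 0

lemma intervalIntegrable_iterate_primitive {g : ℝ → ℝ}
    (hg : ∀ a b, IntervalIntegrable g volume a b) (i : ℕ) (a b : ℝ) :
    IntervalIntegrable (primitive^[i] g) volume a b := by
  cases i with
  | zero => exact hg a b
  | succ i => exact (continuous_iterate_primitive hg i).intervalIntegrable a b

lemma hasDerivAt_iterate_primitive {g : ℝ → ℝ} (hg : ∀ a b, IntervalIntegrable g volume a b)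
    (hm : StronglyMeasurable g) (i : ℕ) (x : ℝ) (hx : 0 < i ∨ ContinuousAt g x) :
    HasDerivAt (primitive^[i + 1] g) (primitive^[i] g x) x := by
  rw [Function.iterate_succ_apply']
  cases i with
  | zero =>
    exact intervalIntegral.integral_hasDerivAt_right (hg 0 x) hm.stronglyMeasurableAtFilter
      (hx.resolve_left (lt_irrefl 0))
  | succ i =>
    have hc := continuous_iterate_primitive hg i
    exact intervalIntegral.integral_hasDerivAt_right (hc.intervalIntegrable 0 x)
      hc.stronglyMeasurable.stronglyMeasurableAtFilter hc.continuousAt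

/-- Continuity at `x` matters only for `j = n`: the last differentiation recovers `g` itself, which
may jump. -/
lemma D_ofReal_iterate_primitive {g : ℝ → ℝ} (hg : ∀ a b, IntervalIntegrable g volume a b)
    (hm : StronglyMeasurable g) {n j : ℕ} (hj : j ≤ n) {x : ℝ} (hx : x ∈ Icc (0 : ℝ) 1)
    (hxj : j < n ∨ ContinuousAt g x) :
    D j (fun y => ((primitive^[n] g y : ℝ) : 𝕜)) x = ((primitive^[n - j] g x : ℝ) : 𝕜) := by
  induction j generalizing x with
  | zero => simp [D]
  | succ j ih =>
    have hcongr : EqOn (D j (fun y => ((primitive^[n] g y : ℝ) : 𝕜)))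
        (fun y => ((primitive^[n - j] g y : ℝ) : 𝕜)) (Icc 0 1) :=
      fun y hy => ih (by omega) hy (Or.inl (by omega))
    have hd : HasDerivAt (primitive^[n - j] g) (primitive^[n - (j + 1)] g x) x := by
      have := hasDerivAt_iterate_primitive hg hm (n - (j + 1)) x
        (hxj.imp (fun h => by omega) id)
      rwa [show n - (j + 1) + 1 = n - j by omega] at this
    have hd' : HasDerivAt (fun y => ((primitive^[n - j] g y : ℝ) : 𝕜))
        ((primitive^[n - (j + 1)] g x : ℝ) : 𝕜) x :=
      (RCLike.ofRealCLM (K := 𝕜)).hasFDerivAt.comp_hasDerivAt x hd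
    rw [D, iteratedDerivWithin_succ, derivWithin_congr hcongr (hcongr hx)]
    exact hd'.hasDerivWithinAt.derivWithin (uniqueDiffOn_Icc zero_lt_one x hx)

lemma iterate_primitive_eq_pairing {g : ℝ → ℝ} (hg : ∀ a b, IntervalIntegrable g volume a b)
    (hm : StronglyMeasurable g) (hsq : SqIntegrable g) (hcont : ∀ᵐ x, ContinuousAt g x) (i : ℕ)
    {b : ℝ} (hb : b ∈ Icc (0 : ℝ) 1) : primitive^[i + 1] g b = pairing (truncPow i b) g := by
  rw [pairing_truncPow i hb hsq]
  refine eq_integral_of_primitives (M := i + 1) (v := fun i => primitive^[i] g) (fun j _ => ?_)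
    (fun j _ => ?_) (fun j _ => ?_) (Nat.lt_succ_self i) hb
  · simp only [Function.iterate_succ_apply']
    exact (intervalIntegrable_iterate_primitive hg j 0
      1).absolutelyContinuousOnInterval_intervalIntegral left_mem_uIcc
  · simp [Function.iterate_succ_apply', primitive]
  · filter_upwards [hcont] with x hx _
    exact (hasDerivAt_iterate_primitive hg hm j x (Or.inr hx)).deriv

/-- The `n`-fold primitive of a square integrable function orthogonal to all polynomials of degree
less than `n` belongs to the Sobolev space. -/
lemma memH_ofReal_iterate_primitive {g : ℝ → ℝ} (hg : ∀ a b, IntervalIntegrable g volume a b)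
    (hm : StronglyMeasurable g) (hsq : SqIntegrable g) (hcont : ∀ᵐ x, ContinuousAt g x) {n : ℕ}
    (horth : ∀ r : ℝ[X], r.degree < n → pairing (fun x => r.eval x) g = 0) :
    MemH n (fun y => ((primitive^[n] g y : ℝ) : 𝕜)) where
  differentiableOn j hj := by
    have hcongr : EqOn (D j (fun y => ((primitive^[n] g y : ℝ) : 𝕜)))
        (fun y => ((primitive^[n - j] g y : ℝ) : 𝕜)) (Icc 0 1) :=
      fun y hy => D_ofReal_iterate_primitive hg hm (by omega) hy (Or.inl (by omega))
    refine DifferentiableOn.congr (fun x _ => ?_) hcongr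
    have hd := hasDerivAt_iterate_primitive hg hm (n - (j + 1)) x (Or.inl (by omega))
    rw [show n - (j + 1) + 1 = n - j by omega] at hd
    exact ((RCLike.ofRealCLM (K := 𝕜)).hasFDerivAt.comp_hasDerivAt x
      hd).differentiableAt.differentiableWithinAt
  absolutelyContinuous j hj := by
    have hac : AbsolutelyContinuousOnInterval (primitive^[n - (j + 1) + 1] g) 0 1 := by
      rw [Function.iterate_succ_apply']
      exact (intervalIntegrable_iterate_primitive hg _ 0
        1).absolutelyContinuousOnInterval_intervalIntegral left_mem_uIcc
    rw [show n - (j + 1) + 1 = n - j by omega] at hac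
    refine AbsolutelyContinuousOnInterval.of_dist_le hac fun x hx y hy => ?_
    rw [uIcc_of_le zero_le_one] at hx hy
    rw [D_ofReal_iterate_primitive hg hm hj.le hx (Or.inl hj),
      D_ofReal_iterate_primitive hg hm hj.le hy (Or.inl hj), dist_eq_norm, ← RCLike.ofReal_sub,
      RCLike.norm_ofReal, Real.dist_eq]
  memLp := by
    refine MemLp.ae_eq ?_ (hsq.ofReal (K := 𝕜))
    filter_upwards [ae_restrict_mem measurableSet_Icc, ae_restrict_of_ae hcont] with x hx hxc
    rw [D_ofReal_iterate_primitive hg hm le_rfl hx (Or.inr hxc), Nat.sub_self]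
    rfl
  left_eq_zero j hj := by
    rw [D_ofReal_iterate_primitive hg hm hj.le (left_mem_Icc.mpr zero_le_one) (Or.inl hj),
      show n - j = n - (j + 1) + 1 by omega, Function.iterate_succ_apply']
    simp [primitive]
  right_eq_zero j hj := by
    have h1 := right_mem_Icc.mpr (zero_le_one (α := ℝ))
    rw [D_ofReal_iterate_primitive hg hm hj.le h1 (Or.inl hj),
      show n - j = n - (j + 1) + 1 by omega, iterate_primitive_eq_pairing hg hm hsq hcont _ h1,
      pairing_truncPow _ h1 hsq]
    set i := n - (j + 1) with hi
    -- On `[0,1]` the truncated power at `1` is a genuine polynomial of degree `i < n`, up to a null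
    -- set.
    have h := horth (C (1 / (i.factorial : ℝ)) * (C 1 - X) ^ i) (by
      have h : (C 1 - X : ℝ[X]).degree = 1 := by
        rw [← degree_neg, neg_sub, degree_X_sub_C]
      rw [degree_C_mul (by positivity), degree_pow, h]
      simp only [nsmul_eq_mul, mul_one]
      exact Nat.cast_lt.mpr (by omega))
    rw [RCLike.ofReal_eq_zero, ← h, pairing]
    congr 1
    ext x
    simp only [eval_mul, eval_C, eval_pow, eval_sub, eval_X]
    ring

lemma normH_ofReal_iterate_primitive {g : ℝ → ℝ} (hg : ∀ a b, IntervalIntegrable g volume a b)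
    (hm : StronglyMeasurable g) (hcont : ∀ᵐ x, ContinuousAt g x) (n : ℕ) :
    normH n (fun y => ((primitive^[n] g y : ℝ) : 𝕜)) = √(pairing g g) := by
  rw [normH, pairing, intervalIntegral.integral_of_le zero_le_one, ← integral_Icc_eq_integral_Ioc]
  congr 1
  refine integral_congr_ae ?_
  filter_upwards [ae_restrict_mem measurableSet_Icc, ae_restrict_of_ae hcont] with x hx hxc
  rw [D_ofReal_iterate_primitive hg hm le_rfl hx (Or.inr hxc), Nat.sub_self, RCLike.norm_ofReal,
    sq_abs, sq, Function.iterate_zero, id]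

lemma stronglyMeasurable_truncPow (d : ℕ) (a : ℝ) : StronglyMeasurable (truncPow d a) := by
  rw [truncPow_eq_indicator]
  exact (Continuous.stronglyMeasurable (by fun_prop)).indicator measurableSet_Iio

lemma intervalIntegrable_truncPow (d : ℕ) (a b c : ℝ) :
    IntervalIntegrable (truncPow d a) volume b c := by
  rw [truncPow_eq_indicator]
  have h : LocallyIntegrable (fun x => (a - x) ^ d / (d.factorial : ℝ)) volume :=
    Continuous.locallyIntegrable (by fun_prop)
  exact ((h.indicator measurableSet_Iio).integrableOn_isCompact isCompact_uIcc).intervalIntegrable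

lemma continuousAt_truncPow (d : ℕ) {a x : ℝ} (hx : x ≠ a) : ContinuousAt (truncPow d a) x := by
  rcases lt_or_gt_of_ne hx with h | h
  · have hc : ContinuousAt (fun y => (a - y) ^ d / (d.factorial : ℝ)) x := by fun_prop
    refine hc.congr ?_
    filter_upwards [Iio_mem_nhds h] with y hy
    exact (if_pos hy).symm
  · refine (continuousAt_const (y := (0 : ℝ))).congr ?_
    filter_upwards [Ioi_mem_nhds h] with y hy
    exact (if_neg (not_lt.mpr (le_of_lt hy))).symm

lemma IsProjection.sqrt_mem_pointValues {k d : ℕ} {a : ℝ} (ha : a ∈ Icc (0 : ℝ) 1) {q : ℝ[X]}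
    (hq : IsProjection (k + d + 1) d a q) :
    √(pairing (fun x => truncPow d a x - q.eval x) (fun x => truncPow d a x - q.eval x)) ∈
      pointValues 𝕜 (k + d + 1) k a := by
  set n := k + d + 1 with hn
  set G : ℝ → ℝ := fun x => truncPow d a x - q.eval x with hG
  set L := √(pairing G G) with hL
  have hLL : L * L = pairing G G := Real.mul_self_sqrt (pairing_self_nonneg G)
  set g : ℝ → ℝ := fun x => L⁻¹ * G x with hgdef
  have hGsq : SqIntegrable G := sqIntegrable_truncPow_sub d a q
  have hsq : SqIntegrable g := hGsq.const_mul _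
  have hg : ∀ b c, IntervalIntegrable g volume b c := fun b c =>
    ((intervalIntegrable_truncPow d a b c).sub (q.continuous.intervalIntegrable b c)).const_mul _
  have hm : StronglyMeasurable g :=
    ((stronglyMeasurable_truncPow d a).sub q.continuous.stronglyMeasurable).const_mul _
  have hcont : ∀ᵐ x, ContinuousAt g x := by
    have hne : ∀ᵐ x : ℝ, x ≠ a := by simp [ae_iff, measure_singleton]
    filter_upwards [hne] with x hx
    exact continuousAt_const.mul ((continuousAt_truncPow d hx).sub q.continuous.continuousAt)
  have hpair : ∀ f : ℝ → ℝ, pairing f g = L⁻¹ * pairing f G := fun f => by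
    rw [pairing_comm, hgdef, pairing_const_mul_left, pairing_comm]
  -- Also true for `L = 0`, where `L⁻¹ = 0` and the extremal function degenerates to zero.
  have hLinv : L⁻¹ * (L * L) = L := by
    by_cases h : L = 0
    · simp [h]
    · field_simp
  refine ⟨fun y => ((primitive^[n] g y : ℝ) : 𝕜), ?_, ?_, ?_⟩
  · refine memH_ofReal_iterate_primitive hg hm hsq hcont fun r hr => ?_
    rw [hpair, hq.orthogonal r hr, mul_zero]
  · rw [normH_ofReal_iterate_primitive hg hm hcont, hpair, pairing_comm, hpair, ← hLL, hLinv,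
      Real.sqrt_le_one]
    exact inv_mul_le_one
  · rw [D_ofReal_iterate_primitive hg hm (by omega) ha (Or.inl (by omega)),
      show n - k = d + 1 by omega, iterate_primitive_eq_pairing hg hm hsq hcont d ha, hpair,
      hq.pairing_truncPow_left, ← hG, ← hLL, hLinv, RCLike.norm_ofReal,
      abs_of_nonneg (Real.sqrt_nonneg _)]

/-- The supremum is attained, and equals the distance from the truncated power to the polynomials
of degree less than `n`. -/
lemma IsProjection.isGreatest_pointValues {k d : ℕ} {a : ℝ} (ha : a ∈ Icc (0 : ℝ) 1) {q : ℝ[X]}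
    (hq : IsProjection (k + d + 1) d a q) :
    IsGreatest (pointValues 𝕜 (k + d + 1) k a)
      √(pairing (fun x => truncPow d a x - q.eval x) (fun x => truncPow d a x - q.eval x)) := by
  refine ⟨hq.sqrt_mem_pointValues ha, ?_⟩
  rintro r ⟨f, hf, hnorm, rfl⟩
  exact Real.le_sqrt_of_sq_le (hf.sq_norm_le hnorm ha hq.degree_lt)

end SobolevPoint

end

/-! ### Degree and normalisation of `B` -/

theorem mainTheorem2 (𝕜 : Type*) [RCLike 𝕜] (n k : ℕ) (hk : k < n) :
    ∃ B : Polynomial ℝ,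
      B.degree = (k : WithBot ℕ) ∧
      B.coeff 0 = ((n : ℝ) - (k : ℝ)) ^ 2 ∧
      ∀ a : ℝ, a ∈ Set.Icc (0 : ℝ) 1 →
        BddAbove (SobolevPoint.pointValues 𝕜 n k a) ∧
        SobolevPoint.A 𝕜 n k a ^ 2 =
          -((a ^ 2 - a) ^ (2 * n - 2 * k - 1) /
              (((n - k).factorial : ℝ) ^ 2 * (2 * (n : ℝ) - 2 * (k : ℝ) - 1))) *
            B.eval (a ^ 2 - a) := by
  obtain ⟨d, rfl⟩ : ∃ d, n = k + d + 1 := ⟨n - k - 1, by omega⟩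
  obtain ⟨P, W, hdeg, hPW, hsym, hproj⟩ :=
    SobolevPoint.exists_distance_polynomial (N := k + d + 1) (d := d) (by omega)
  have hP0 : P ≠ 0 := by
    rintro rfl
    simp at hdeg
  obtain ⟨S, hS, hS0, hSdeg⟩ := SobolevPoint.exists_pow_mul_comp_of_symmetric_of_odd
    (odd_two_mul_add_one d) hsym hPW hP0
  have hSne : S ≠ 0 := by
    rintro rfl
    apply hP0
    rw [hS]
    simp
  have hfac : ((d + 1).factorial : ℝ) = (d + 1) * d.factorial := by
    rw [Nat.factorial_succ]
    push_cast
    ring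
  have hdpos : (0 : ℝ) < d.factorial := by exact_mod_cast d.factorial_pos
  have hd1 : (0 : ℝ) < 2 * d + 1 := by positivity
  -- Cancels the prefactor of the claim; as `S(0) = -1 / ((2d+1) d!²)`, the constant term of `e S`
  -- is `(d + 1)² = (n - k)²`.
  set e : ℝ := -(((d + 1).factorial : ℝ) ^ 2 * (2 * d + 1)) with he
  have he0 : e ≠ 0 := neg_ne_zero.mpr (by positivity)
  refine ⟨Polynomial.C e * S, ?_, ?_, fun a ha => ?_⟩
  -- The degree of `S` comes from `2(n + d) = 2(2d + 1) + 2 deg S` with `n = k + d + 1`.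
  · rw [Polynomial.degree_C_mul he0, Polynomial.degree_eq_natDegree hSne]
    congr 1
    omega
  · rw [Polynomial.coeff_C_mul, hS0, he, hfac]
    push_cast
    field_simp
    ring
  · obtain ⟨q, hq, hqP⟩ := hproj a ha
    have hG := hq.isGreatest_pointValues (𝕜 := 𝕜) ha
    refine ⟨hG.bddAbove, ?_⟩
    rw [SobolevPoint.A, hG.csSup_eq, Real.sq_sqrt (SobolevPoint.pairing_self_nonneg _), hqP, hS,
      show 2 * (k + d + 1) - 2 * k - 1 = 2 * d + 1 by omega,
      show k + d + 1 - k = d + 1 by omega]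
    have hcast : 2 * ((k + d + 1 : ℕ) : ℝ) - 2 * (k : ℝ) - 1 = 2 * d + 1 := by
      push_cast
      ring
    rw [hcast]
    simp only [Polynomial.eval_mul, Polynomial.eval_pow, Polynomial.eval_sub, Polynomial.eval_X,
      Polynomial.eval_comp, Polynomial.eval_C]
    rw [he]
    field_simp
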